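/- Let $d\in\mathbb{N}$ and equip $\mathbb{R}^d$ with the Euclidean norm. For $A\subset\mathbb{R}^d$ let $d_A(x)=\inf_{a\in A}\|x-a\|$ be the distance function to $A$, and let ${}^{\neg}A=\overline{\mathbb{R}^d\setminus A}$. For a locally Lipschitz function $\phi:\mathbb{R}^d\to\mathbb{R}$, the Clarke gradient $\partial^*\phi(x)$ is the convex hull of all limits $\lim_n\nabla\phi(x_n)$ with $x_n\to x$ and $\phi$ differentiable at every $x_n$. For $S\subset\mathbb{R}^d$ put $\Delta(S)=\inf\{\|v\| : v\in S\}$. For $\mu\in(0,1]$ let $$\mathrm{reach}_\mu(A)=\sup\{s : \text{for all } x,\ 0<d_A(x)\le s \implies \Delta(\partial^*d_A(x))\ge\mu\},$$ and let $\mathrm{reach}(A)$ be the supremum of the $t$ such that every $x$ with $d_A(x)<t$ has a unique closest point in $A$ (by convention $d_\emptyset=+\infty$ and $\mathrm{reach}(\emptyset)=+\infty$ here). A compact set $X\subset\mathbb{R}^d$ is called *complementary regular* if $\overline{\mathrm{int}(X)}=X$, $\mathrm{reach}_\mu(X)>0$ for some $\mu\in(0,1]$, and $\mathrm{reach}({}^{\neg}X)>0$.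 The tangent cone $\mathrm{Tan}(A,x)$ is the cone generated by the limits of $\frac{x_n-x}{\|x_n-x\|}$ with $x_n\in A\setminus\{x\}$, $x_n\to x$. For $X$ complementary regular and $x\in X$, let $\mathrm{Nor}(X,x)=-\{u : \langle u,v\rangle\le 0\ \ \forall v\in\mathrm{Tan}({}^{\neg}X,x)\}$ if $x\in\partial X$, and $\mathrm{Nor}(X,x)=\{0\}$ if $x\in\mathrm{int}(X)$. For $f:\mathbb{R}^d\to\mathbb{R}$ of class $C^2$, a point $x\in X$ is a critical point of $f_{|X}$ if $\nabla f(x)\in-\mathrm{Nor}(X,x)$, and $c\in\mathbb{R}$ is a regular value of $f_{|X}$ if no critical point $x$ of $f_{|X}$ satisfies $f(x)=c$. Write $X_c=X\cap f^{-1}(-\infty,c]$. **Theorem (constant homotopy type between critical values).** Let $X\subset\mathbb{R}^d$ be complementary regular, let $f:\mathbb{R}^d\to\mathbb{R}$ be of class $C^2$, and let $a<b$ be real numbers such that every $c\in[a,b]$ is a regular value of $f_{|X}$. Then $X_a$ is a deformation retract of $X_b$: there is a continuous map $H:[0,1]\times X_b\to X_b$ with $H(0,x)=x$ and $H(1,x)\in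 X_a$ for all $x\in X_b$, and $H(t,x)=x$ for all $x\in X_a$ and $t\in[0,1]$. -/

import Mathlib

open Set Filter Topology
open scoped ENNReal unitInterval

noncomputable section

/-- The Euclidean space `ℝᵈ`. -/
abbrev Euc (d : ℕ) : Type := EuclideanSpace ℝ (Fin d)

/-- The complement set of `X`, i.e. the closure of its set-theoretic complement. -/
def complementSet {d : ℕ} (X : Set (Euc d)) : Set (Euc d) := closure Xᶜ

/-- The distance function `d_X` to the set `X`. -/
def distFun {d : ℕ} (X : Set (Euc d)) : Euc d → ℝ := fun x => Metric.infDist x X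

/-- The Clarke gradient of `φ` at `x`: the convex hull of the limits of the gradients of `φ`
at differentiability points converging to `x`. -/
def clarkeGradient {d : ℕ} (φ : Euc d → ℝ) (x : Euc d) : Set (Euc d) :=
  convexHull ℝ {v | ∃ u : ℕ → Euc d, Tendsto u atTop (𝓝 x) ∧
    (∀ n, DifferentiableAt ℝ φ (u n)) ∧
    Tendsto (fun n => gradient φ (u n)) atTop (𝓝 v)}

/-- `Δ(S)`, the infimum of the norms of the elements of `S`, i.e. the distance from `0` to `S`. -/
def minNorm {d : ℕ} (S : Set (Euc d)) : ℝ := Metric.infDist 0 S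

/-- The `μ`-reach of `X`: the supremum of the `s` such that the Clarke gradient of `d_X` stays at
distance at least `μ` from `0` at all points `x` with `0 < d_X(x) ≤ s`. -/
def muReach {d : ℕ} (μ : ℝ) (X : Set (Euc d)) : ℝ≥0∞ :=
  sSup {s : ℝ≥0∞ | ∀ x : Euc d, 0 < Metric.infEDist x X → Metric.infEDist x X ≤ s →
    μ ≤ minNorm (clarkeGradient (distFun X) x)}

/-- The reach of `A`: the supremum of the `t` such that every point at distance less than `t` from
`A` has a unique closest point in `A` (the reach of the empty set is infinite). -/
def reach {d : ℕ} (A : Set (Euc d)) : ℝ≥0∞ :=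
  sSup {t : ℝ≥0∞ | ∀ x : Euc d, Metric.infEDist x A < t →
    ∃! z, z ∈ A ∧ edist x z = Metric.infEDist x A}

/-- Complementary regular sets. -/
structure IsComplementaryRegular {d : ℕ} (X : Set (Euc d)) : Prop where
  isCompact : IsCompact X
  closure_interior : closure (interior X) = X
  muReach_pos : ∃ μ : ℝ, 0 < μ ∧ μ ≤ 1 ∧ 0 < muReach μ X
  reach_complementSet_pos : 0 < reach (complementSet X)

/-- The tangent cone of `A` at `x`: the cone generated by the limits of
`(xₙ - x) / ‖xₙ - x‖`, where `xₙ ∈ A \ {x}` converges to `x`. -/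
def tanCone {d : ℕ} (A : Set (Euc d)) (x : Euc d) : Set (Euc d) :=
  {v | ∃ (l : ℝ) (w : Euc d), 0 ≤ l ∧ v = l • w ∧
    ∃ u : ℕ → Euc d, (∀ n, u n ∈ A ∧ u n ≠ x) ∧ Tendsto u atTop (𝓝 x) ∧
      Tendsto (fun n => ‖u n - x‖⁻¹ • (u n - x)) atTop (𝓝 w)}

/-- The polar cone of `B`. -/
def polarCone {d : ℕ} (B : Set (Euc d)) : Set (Euc d) :=
  {u | ∀ b ∈ B, inner ℝ u b ≤ 0}

/-- The normal cone at a point `x ∈ X`, for a set `X` whose complement set has positive reach: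
the opposite of the polar of the tangent cone of the complement set when `x` is a boundary point,
and `{0}` when `x` is an interior point. -/
def norCone {d : ℕ} (X : Set (Euc d)) (x : Euc d) : Set (Euc d) :=
  {n | (x ∈ frontier X → -n ∈ polarCone (tanCone (complementSet X) x)) ∧
    (x ∉ frontier X → n = 0)}

/-- `x` is a critical point of `f|_X`: `x ∈ X` and `∇f(x) ∈ -Nor(X, x)`. -/
def IsCriticalPointOn {d : ℕ} (f : Euc d → ℝ) (X : Set (Euc d)) (x : Euc d) : Prop :=
  x ∈ X ∧ -gradient f x ∈ norCone X x

/-- `c` is a regular value of `f|_X`: no critical point of `f|_X` has value `c`. -/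
def IsRegularValueOn {d : ℕ} (f : Euc d → ℝ) (X : Set (Euc d)) (c : ℝ) : Prop :=
  ¬ ∃ x, IsCriticalPointOn f X x ∧ f x = c

/-- The sublevel set `X_c = X ∩ f⁻¹(-∞, c]`. -/
def sublevelOn {d : ℕ} (f : Euc d → ℝ) (X : Set (Euc d)) (c : ℝ) : Set (Euc d) :=
  X ∩ f ⁻¹' Iic c

/-- `A` is a (strong) deformation retract of `B`: `A ⊆ B`, and the identity of `B` is homotopic,
relatively to `A`, to a continuous map of `B` into itself with values in `A`. -/
def IsDeformationRetract {Y : Type*} [TopologicalSpace Y] (A B : Set Y) : Prop :=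
  A ⊆ B ∧ ∃ r : C(B, B), (∀ y, (r y : Y) ∈ A) ∧
    ContinuousMap.HomotopicRel (ContinuousMap.id B) r {y : B | (y : Y) ∈ A}

end

/-! Let `C` be the closure of the complement of `X`. A unit normal to `C` at `x` with radius `r`
carries an open ball, tangent at `x`, that misses `C` and so lies in `X`; such vectors serve as
inward normals of `X`. Positive reach of `C` gives these normals a uniform radius and a closed
graph.

The μ-reach of `X` forces the normals at `x` into an open half-space
(`exists_forall_unitNormals_inner_pos`). Otherwise every `z` near `x` is on the nonnegative side of
some normal, whose ball gives `d_X(z) ≤ ‖z - x‖² / r`; but the Clarke bound makes `d_X` grow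
linearly from points outside `X` arbitrarily close to `x`. So strictly inward vectors exist.
Non-criticality supplies a tangent vector `τ` of `C` along which `f` increases, and `-τ` plus a
small strictly inward vector is strictly inward and decreases `f`.

Strictness is an open condition, so a partition of unity yields a `C¹` compactly supported field,
inward for `X` and decreasing `f` at unit rate at least on `X ∩ f⁻¹[a, b]`. A ball outside `X`
touching it at `p` has its direction opposite to the inward normal, so Gronwall applied to `d_X²`
shows that the flow preserves `X`. Flowing `x` for time `max (f x - a) 0` gives the retraction. -/

/-! ### Growth of functions along ascent directions -/

section Ascent

/-- If a continuous function can be increased with slope at least `m` from every point of an open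
ball lying above the centre, it increases by at least `m * t` up to some point of the sphere. -/
theorem exists_dist_eq_add_mul_le_of_ascent {Y : Type*} [PseudoMetricSpace Y] [ProperSpace Y]
    {g : Y → ℝ} (hg : Continuous g) {y : Y} {t m : ℝ} (ht : 0 ≤ t) (hm : 0 ≤ m)
    (hasc : ∀ z, dist z y < t → g y ≤ g z →
      ∀ δ > 0, ∃ z', dist z' z < δ ∧ g z + m * dist z' z < g z') :
    ∃ z, dist z y = t ∧ g y + m * t ≤ g z := by
  -- A maximiser of the penalised function cannot be interior: a step of slope above `m` gains more
  -- than the penalty costs.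
  obtain ⟨z, hz, hmax⟩ := (isCompact_closedBall y t).exists_isMaxOn
    (f := fun z => g z - m * dist z y) ⟨y, Metric.mem_closedBall_self ht⟩ (by fun_prop)
  have hzy : g y ≤ g z - m * dist z y := by
    simpa using hmax (Metric.mem_closedBall_self ht)
  have hzt : dist z y = t := by
    refine le_antisymm hz (not_lt.1 fun hlt => ?_)
    obtain ⟨z', hz', hgz'⟩ := hasc z hlt
      (by nlinarith [mul_nonneg hm (dist_nonneg (x := z) (y := y))]) (t - dist z y) (by linarith)
    have htri := dist_triangle z' z y
    have h1 : g z' - m * dist z' y ≤ g z - m * dist z y :=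
      hmax (Metric.mem_closedBall.2 (by linarith))
    nlinarith [mul_le_mul_of_nonneg_left htri hm]
  exact ⟨z, hzt, by rw [← hzt]; linarith⟩

variable {E : Type*} [NormedAddCommGroup E] [InnerProductSpace ℝ E]

/-- The distance function increases with slope at least `m` in a direction making a small enough
angle with all the directions to `z` from its nearest points. -/
theorem exists_infDist_add_mul_lt_of_inner [ProperSpace E] {A : Set E} (hA : IsClosed A)
    (hne : A.Nonempty) {z v : E} {m : ℝ} (hv : ‖v‖ = 1) (hm : 0 ≤ m) (hm1 : m ≤ 1)
    (h : ∀ p ∈ A, dist z p = Metric.infDist z A → m * Metric.infDist z A < inner ℝ v (z - p))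
    {δ : ℝ} (hδ : 0 < δ) :
    ∃ z', dist z' z < δ ∧ Metric.infDist z A + m * dist z' z < Metric.infDist z' A := by
  set d := Metric.infDist z A with hd
  -- By compactness the strict inequality extends to almost nearest points: those violating it stay
  -- at distance bounded away from `d`.
  obtain ⟨ε, hε, hpε⟩ : ∃ ε > 0, ∀ p ∈ A, dist z p < d + ε → m * d < inner ℝ v (z - p) := by
    set K := {p | p ∈ A ∧ dist z p ≤ d + 1 ∧ inner ℝ v (z - p) ≤ m * d} with hK
    have hKc : IsCompact K := by
      refine (isCompact_closedBall z (d + 1)).of_isClosed_subset ?_ fun p hp => ?_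
      · have h1 : IsClosed {p | dist z p ≤ d + 1} := isClosed_le (by fun_prop) (by fun_prop)
        have h2 : IsClosed {p | inner ℝ v (z - p) ≤ m * d} :=
          isClosed_le (by fun_prop) (by fun_prop)
        exact hA.inter (h1.inter h2)
      · simpa [dist_comm] using hp.2.1
    rcases K.eq_empty_or_nonempty with hKe | hKn
    · refine ⟨1, one_pos, fun p hp hpd => not_le.1 fun hle => ?_⟩
      exact eq_empty_iff_forall_notMem.1 hKe p ⟨hp, hpd.le, hle⟩
    · obtain ⟨q, hq, hmin⟩ := hKc.exists_isMinOn hKn (f := fun p => dist z p) (by fun_prop)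
      have hdq : d < dist z q :=
        lt_of_le_of_ne (Metric.infDist_le_dist_of_mem hq.1) fun he =>
          (h q hq.1 he.symm).not_ge hq.2.2
      refine ⟨min 1 (dist z q - d), lt_min one_pos (by linarith), fun p hp hpd => ?_⟩
      have h1 := min_le_left 1 (dist z q - d)
      have h2 := min_le_right 1 (dist z q - d)
      refine not_le.1 fun hle => ?_
      have : dist z q ≤ dist z p := hmin (⟨hp, by linarith, hle⟩ : p ∈ K)
      linarith
  -- The nearest point of `z + s • v` lies within `d + 2 * s < d + ε` of `z`.
  set s := min (δ / 2) (ε / 3) with hs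
  have hs0 : 0 < s := lt_min (by linarith) (by linarith)
  have hs1 : s ≤ δ / 2 := min_le_left _ _
  have hs2 : s ≤ ε / 3 := min_le_right _ _
  have hdz : dist (z + s • v) z = s := by
    simp [dist_eq_norm, norm_smul, hv, abs_of_pos hs0]
  refine ⟨z + s • v, by linarith, ?_⟩
  obtain ⟨p, hp, hpd⟩ := hA.exists_infDist_eq_dist hne (z + s • v)
  have h1 : Metric.infDist (z + s • v) A ≤ d + s := by
    have := Metric.infDist_le_infDist_add_dist (s := A) (x := z + s • v) (y := z)
    linarith
  have h2 : dist z p ≤ s + Metric.infDist (z + s • v) A := by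
    rw [hpd]
    have := dist_triangle z (z + s • v) p
    rwa [dist_comm z (z + s • v), hdz] at this
  have h3 := hpε p hp (by linarith)
  have h4 : d ≤ ‖z - p‖ := by
    rw [← dist_eq_norm]; exact Metric.infDist_le_dist_of_mem hp
  have h5 : (dist (z + s • v) p) ^ 2 = ‖z - p‖ ^ 2 + 2 * s * inner ℝ v (z - p) + s ^ 2 := by
    rw [dist_eq_norm, show z + s • v - p = (z - p) + s • v by abel, norm_add_sq_real,
      norm_smul, hv, inner_smul_right, real_inner_comm]
    simp; ring
  have hd0 : 0 ≤ d := Metric.infDist_nonneg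
  rw [hdz, hpd]
  refine lt_of_pow_lt_pow_left₀ 2 dist_nonneg ?_
  rw [h5]
  have h6 : d ^ 2 ≤ ‖z - p‖ ^ 2 := by gcongr
  have h7 : (m * s) ^ 2 ≤ s ^ 2 := by
    have : m * s ≤ s := by nlinarith
    gcongr
  nlinarith [mul_lt_mul_of_pos_left h3 hs0]

end Ascent

/-! ### Normals with a ball of fixed radius -/

section UnitNormals

variable {E : Type*} [NormedAddCommGroup E] [InnerProductSpace ℝ E]

/-- The unit vectors `n` such that the open ball of radius `r` centred at `x + r • n` does not
meet `C`. -/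
def unitNormals (C : Set E) (r : ℝ) (x : E) : Set E :=
  {n | x ∈ C ∧ ‖n‖ = 1 ∧ ∀ c ∈ C, 2 * r * inner ℝ n (c - x) ≤ ‖c - x‖ ^ 2}

/-- With `r` fixed, normality is a family of closed conditions on the pair. This gives normals as
limits of normals and the openness of strict inwardness. -/
theorem isClosed_unitNormals_graph {C : Set E} (hC : IsClosed C) (r : ℝ) :
    IsClosed {q : E × E | q.2 ∈ unitNormals C r q.1} := by
  have : {q : E × E | q.2 ∈ unitNormals C r q.1} = (Prod.fst ⁻¹' C) ∩ ({q | ‖q.2‖ = 1} ∩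
      ⋂ c ∈ C, {q | 2 * r * inner ℝ q.2 (c - q.1) ≤ ‖c - q.1‖ ^ 2}) := by
    ext q; simp [unitNormals]
  rw [this]
  refine (hC.preimage continuous_fst).inter ((isClosed_eq (by fun_prop) (by fun_prop)).inter ?_)
  exact isClosed_biInter fun c _ => isClosed_le (by fun_prop) (by fun_prop)

theorem isCompact_unitNormals [ProperSpace E] {C : Set E} (hC : IsClosed C) (r : ℝ) (x : E) :
    IsCompact (unitNormals C r x) := by
  refine (isCompact_sphere (0 : E) 1).of_isClosed_subset ?_ fun n hn => by simpa using hn.2.1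
  exact (isClosed_unitNormals_graph hC r).preimage (f := fun n => (x, n)) (by fun_prop)

/-- Where nearest points are unique up to distance `r`, the direction from the nearest point is a
normal with a ball of radius `r`. -/
theorem smul_sub_mem_unitNormals [ProperSpace E] {A : Set E} (hA : IsClosed A) {r : ℝ}
    (huniq : ∀ z, Metric.infDist z A < r → ∀ p ∈ A, ∀ q ∈ A,
      dist z p = Metric.infDist z A → dist z q = Metric.infDist z A → p = q)
    {y p : E} (hp : p ∈ A) (hyp : dist y p = Metric.infDist y A)
    (hy0 : 0 < Metric.infDist y A) (hyr : Metric.infDist y A < r) :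
    (Metric.infDist y A)⁻¹ • (y - p) ∈ unitNormals A r p := by
  set d := Metric.infDist y A with hd
  have hnorm : ‖y - p‖ = d := by rw [← dist_eq_norm, hyp]
  have hne : A.Nonempty := ⟨p, hp⟩
  have hcont : Continuous fun z => Metric.infDist z A := Metric.continuous_infDist_pt A
  -- With a unique nearest point the distance has ascent slope arbitrarily close to 1, and
  -- uniqueness holds until distance `r` is reached.
  have key : ∀ m : ℝ, 0 ≤ m → m < 1 →
      ∃ z, dist z y = r - d ∧ d + m * (r - d) ≤ Metric.infDist z A := by
    intro m hm hm1
    refine exists_dist_eq_add_mul_le_of_ascent hcont (by linarith) hm fun z hz hgz δ hδ => ?_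
    have hz0 : 0 < Metric.infDist z A := lt_of_lt_of_le hy0 hgz
    have hzr : Metric.infDist z A < r := by
      have := Metric.infDist_le_infDist_add_dist (s := A) (x := z) (y := y)
      linarith
    obtain ⟨q, hq, hzq⟩ := hA.exists_infDist_eq_dist hne z
    have hq0 : ‖z - q‖ = Metric.infDist z A := by rw [hzq, dist_eq_norm]
    refine exists_infDist_add_mul_lt_of_inner hA hne (v := (Metric.infDist z A)⁻¹ • (z - q))
      ?_ hm hm1.le (fun q' hq' hzq' => ?_) hδ
    · rw [norm_smul, hq0, norm_inv, Real.norm_of_nonneg hz0.le, inv_mul_cancel₀ hz0.ne']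
    · rw [huniq z hzr q' hq' q hq hzq' hzq.symm, inner_smul_left, real_inner_self_eq_norm_sq, hq0]
      simp only [conj_trivial]
      rw [sq, inv_mul_cancel_left₀ hz0.ne']
      nlinarith
  obtain ⟨z, hz, hmax⟩ := (isCompact_sphere y (r - d)).exists_isMaxOn
    (f := fun z => Metric.infDist z A)
    (by obtain ⟨z, hz, -⟩ := key 0 le_rfl one_pos; exact ⟨z, hz⟩) hcont.continuousOn
  have hz' : dist z y = r - d := hz
  have hzr : r ≤ Metric.infDist z A := by
    refine le_of_forall_pos_le_add fun ε hε => ?_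
    have hrd : 0 < r - d := by linarith
    rcases le_or_gt (r - d) ε with h | h
    · obtain ⟨w, hw, hw'⟩ := key 0 le_rfl one_pos
      have : Metric.infDist w A ≤ Metric.infDist z A := hmax hw
      linarith
    · obtain ⟨w, hw, hw'⟩ := key (1 - ε / (r - d))
        (by rw [sub_nonneg, div_le_one hrd]; exact h.le)
        (by have := div_pos hε hrd; linarith)
      have : Metric.infDist w A ≤ Metric.infDist z A := hmax hw
      rw [sub_mul, div_mul_cancel₀ _ hrd.ne'] at hw'
      linarith
  have hzy : ‖z - y‖ = r - d := by rw [← dist_eq_norm, hz']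
  -- Since `‖z - p‖ ≥ r`, the triangle inequality is an equality, which puts `z` on the ray from `p`
  -- through `y`.
  have hsum : ‖(z - y) + (y - p)‖ = ‖z - y‖ + ‖y - p‖ := by
    refine le_antisymm (norm_add_le _ _) ?_
    rw [hzy, hnorm, sub_add_sub_cancel, ← dist_eq_norm]
    have := Metric.infDist_le_dist_of_mem (x := z) hp
    linarith
  have hray := (sameRay_iff_norm_add.2 hsum).norm_smul_eq
  rw [hzy, hnorm] at hray
  set n := d⁻¹ • (y - p) with hn
  have hyn : y - p = d • n := by rw [hn, smul_inv_smul₀ hy0.ne']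
  have hzn : z - p = r • n := by
    have : z - y = (r - d) • n := by
      rw [hn, smul_comm, hray, inv_smul_smul₀ hy0.ne']
    rw [← sub_add_sub_cancel z y p, this, hyn, ← add_smul, sub_add_cancel]
  have hn1 : ‖n‖ = 1 := by
    rw [hn, norm_smul, hnorm, norm_inv, Real.norm_of_nonneg hy0.le, inv_mul_cancel₀ hy0.ne']
  refine ⟨hp, hn1, fun c hc => ?_⟩
  have h1 : r ≤ ‖z - c‖ := by
    rw [← dist_eq_norm]; exact hzr.trans (Metric.infDist_le_dist_of_mem hc)
  have h2 : r ^ 2 ≤ ‖z - c‖ ^ 2 := by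
    have : 0 < r := by linarith
    gcongr
  rw [← sub_sub_sub_cancel_right z c p, hzn, norm_sub_sq_real, norm_smul, hn1, mul_one,
    Real.norm_eq_abs, sq_abs, inner_smul_left] at h2
  simp only [conj_trivial] at h2
  linarith

/-- Under uniqueness of nearest points up to distance `r`, unit normals exist at limits of points
of the complement. -/
theorem unitNormals_nonempty [ProperSpace E] {A : Set E} (hA : IsClosed A) {r : ℝ} (hr : 0 < r)
    (huniq : ∀ z, Metric.infDist z A < r → ∀ p ∈ A, ∀ q ∈ A,
      dist z p = Metric.infDist z A → dist z q = Metric.infDist z A → p = q)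
    {x : E} (hx : x ∈ A) (hxc : x ∈ closure Aᶜ) : (unitNormals A r x).Nonempty := by
  obtain ⟨u, huA, hux⟩ := mem_closure_iff_seq_limit.1 hxc
  have hne : A.Nonempty := ⟨x, hx⟩
  choose p hp hup using fun k => hA.exists_infDist_eq_dist hne (u k)
  have hupos : ∀ k, 0 < Metric.infDist (u k) A := fun k =>
    (hA.notMem_iff_infDist_pos hne).1 (huA k)
  have hu0 : Tendsto (fun k => dist (u k) x) atTop (𝓝 0) := tendsto_iff_dist_tendsto_zero.1 hux
  have hud : ∀ k, dist (u k) (p k) ≤ dist (u k) x := fun k => by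
    rw [← hup k]; exact Metric.infDist_le_dist_of_mem hx
  have hpx : Tendsto p atTop (𝓝 x) := by
    rw [tendsto_iff_dist_tendsto_zero]
    refine squeeze_zero (fun _ => dist_nonneg) (fun k => ?_) (by simpa using hu0.add hu0)
    have := dist_triangle_left (p k) x (u k)
    linarith [hud k]
  have hmem : ∀ᶠ k in atTop, (Metric.infDist (u k) A)⁻¹ • (u k - p k) ∈ unitNormals A r (p k) := by
    filter_upwards [hu0.eventually_lt_const hr] with k hk
    refine smul_sub_mem_unitNormals hA huniq (hp k) (hup k).symm (hupos k) ?_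
    rw [hup k]; exact (hud k).trans_lt hk
  obtain ⟨n, -, φ, hφ, hn⟩ := (isCompact_sphere (0 : E) 1).tendsto_subseq
    (x := fun k => (Metric.infDist (u k) A)⁻¹ • (u k - p k)) fun k => by
      rw [mem_sphere_zero_iff_norm, norm_smul, ← dist_eq_norm, ← hup k, norm_inv,
        Real.norm_of_nonneg (hupos k).le, inv_mul_cancel₀ (hupos k).ne']
  exact ⟨n, (isClosed_unitNormals_graph hA r).mem_of_tendsto
    ((hpx.comp hφ.tendsto_atTop).prodMk_nhds hn) (hφ.tendsto_atTop.eventually hmem)⟩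

/-- If a ball inside `C` touches `C` at a point with unit normals, it determines the normal. -/
theorem eq_neg_of_mem_unitNormals_of_closedBall_subset {C : Set E} {r ρ : ℝ} (hr : 0 < r)
    (hρ : 0 < ρ) {p n ν : E} (hν : ‖ν‖ = 1) (hn : n ∈ unitNormals C r p)
    (hball : Metric.closedBall (p + ρ • ν) ρ ⊆ C) : n = -ν := by
  obtain ⟨-, hn1, hn⟩ := hn
  by_contra hne
  have hpos : 0 < ‖ν + n‖ ^ 2 := by
    have : ν + n ≠ 0 := fun h => hne (eq_neg_of_add_eq_zero_right h)
    positivity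
  have hsq : ‖ν + n‖ ^ 2 = 2 * (1 + inner ℝ ν n) := by
    rw [norm_add_sq_real, hν, hn1]; ring
  have hcomm : inner ℝ n ν = inner ℝ ν n := real_inner_comm _ _
  -- Test point `p + s • (ν + n)`: `s ≤ ρ` keeps it in the ball, while the normal inequality there
  -- would force `r ≤ s`.
  set s := min ρ (r / 2) with hs
  have hs0 : 0 < s := lt_min hρ (by linarith)
  have hs1 : s ≤ ρ := min_le_left _ _
  have hs2 : s ≤ r / 2 := min_le_right _ _
  have hmem : p + s • (ν + n) ∈ C := by
    refine hball ?_
    rw [mem_closedBall_iff_norm]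
    refine le_of_sq_le_sq ?_ hρ.le
    rw [add_sub_add_left_eq_sub, norm_sub_sq_real, norm_smul, norm_smul, hν, inner_smul_left,
      inner_smul_right, inner_add_left, real_inner_self_eq_norm_sq, hν, mul_pow, hsq,
      hcomm]
    simp only [conj_trivial, Real.norm_eq_abs, sq_abs, mul_one, one_pow]
    nlinarith [mul_le_mul_of_nonneg_left hs1 (mul_nonneg hs0.le (hsq ▸ hpos.le))]
  have h := hn _ hmem
  rw [add_sub_cancel_left, inner_smul_right, inner_add_right, real_inner_self_eq_norm_sq, hn1,
    norm_smul, mul_pow, hsq, hcomm] at h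
  simp only [Real.norm_eq_abs, sq_abs] at h
  nlinarith [mul_pos hs0 (hsq ▸ hpos)]

end UnitNormals

/-! ### Convex separation and differentiability of the distance -/

section Separation

variable {E : Type*} [NormedAddCommGroup E] [InnerProductSpace ℝ E]

/-- The element of least norm of the closed convex hull of a set. -/
theorem exists_mem_closure_convexHull_norm_sq_le_inner [CompleteSpace E] {N : Set E}
    (hN : N.Nonempty) : ∃ v ∈ closure (convexHull ℝ N), ∀ n ∈ N, ‖v‖ ^ 2 ≤ inner ℝ v n := by
  have hconv : Convex ℝ (closure (convexHull ℝ N)) := (convex_convexHull ℝ N).closure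
  obtain ⟨v, hv, hmin⟩ := exists_norm_eq_iInf_of_complete_convex
    (hN.convexHull (𝕜 := ℝ)).closure isClosed_closure.isComplete hconv 0
  refine ⟨v, hv, fun n hn => ?_⟩
  have h := (norm_eq_iInf_iff_real_inner_le_zero hconv hv).1 hmin n
    (subset_closure (subset_convexHull ℝ N hn))
  rw [zero_sub, inner_neg_left, inner_sub_right, real_inner_self_eq_norm_sq] at h
  linarith

/-- Either a compact set lies in an open half-space, or it meets all closed half-spaces. -/
theorem IsCompact.exists_forall_inner_pos_or [CompleteSpace E] {N : Set E} (hN : IsCompact N) :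
    (∃ v, ∀ n ∈ N, 0 < inner ℝ n v) ∨ ∀ w, ∃ n ∈ N, 0 ≤ inner ℝ n w := by
  rcases N.eq_empty_or_nonempty with rfl | hne
  · exact Or.inl ⟨0, by simp⟩
  obtain ⟨v, hv, hmin⟩ := exists_mem_closure_convexHull_norm_sq_le_inner hne
  rcases eq_or_ne v 0 with rfl | hv0
  · refine Or.inr fun w => ?_
    obtain ⟨n, hn, hmax⟩ := hN.exists_isMaxOn hne (f := fun n => inner ℝ n w) (by fun_prop)
    refine ⟨n, hn, ?_⟩
    have hsub : closure (convexHull ℝ N) ⊆ {k | inner ℝ k w ≤ inner ℝ n w} := by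
      refine closure_minimal (convexHull_min (fun k hk => hmax hk) ?_)
        (isClosed_le (by fun_prop) (by fun_prop))
      exact convex_halfSpace_le (𝕜 := ℝ)
        (f := fun k => inner ℝ k w) ⟨fun x y => inner_add_left x y w,
          fun c x => by simp [inner_smul_left]⟩ _
    simpa using hsub hv
  · refine Or.inl ⟨v, fun n hn => ?_⟩
    rw [real_inner_comm]
    exact lt_of_lt_of_le (by positivity) (hmin n hn)

/-- Tangent quadratic upper bound for the norm. -/
theorem norm_add_le_of_pos {u h : E} (hu : 0 < ‖u‖) :
    ‖u + h‖ ≤ ‖u‖ + inner ℝ (‖u‖⁻¹ • u) h + ‖h‖ ^ 2 / (2 * ‖u‖) := by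
  have h1 : ‖u + h‖ ^ 2 = ‖u‖ ^ 2 + 2 * inner ℝ u h + ‖h‖ ^ 2 := norm_add_sq_real u h
  have h2 : ‖u‖ + inner ℝ (‖u‖⁻¹ • u) h + ‖h‖ ^ 2 / (2 * ‖u‖)
      = (‖u + h‖ ^ 2 + ‖u‖ ^ 2) / (2 * ‖u‖) := by
    rw [h1, inner_smul_left]
    simp only [conj_trivial]
    field_simp
    ring
  rw [h2, le_div_iff₀ (by positivity)]
  nlinarith [sq_nonneg (‖u + h‖ - ‖u‖)]

/-- The distance function is differentiable inside a segment to a nearest point. -/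
theorem hasGradientAt_infDist_lineMap [CompleteSpace E] {A : Set E} {z p : E} (hp : p ∈ A)
    (hzp : dist z p = Metric.infDist z A) {s : ℝ} (hs0 : 0 < s) (hs1 : s < 1)
    (hpos : 0 < Metric.infDist z A) :
    HasGradientAt (fun x => Metric.infDist x A) ((Metric.infDist z A)⁻¹ • (z - p))
      (z + s • (p - z)) := by
  set d := Metric.infDist z A with hd
  set u := z + s • (p - z) with hu
  set n := d⁻¹ • (z - p) with hn
  have hnorm : ‖z - p‖ = d := by rw [← dist_eq_norm, hzp]
  have hup : u - p = (1 - s) • (z - p) := by rw [hu]; module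
  have huz : u - z = -(s • (z - p)) := by rw [hu]; module
  have hs1' : 0 < 1 - s := by linarith
  have hup1 : ‖u - p‖ = (1 - s) * d := by
    rw [hup, norm_smul, Real.norm_of_nonneg hs1'.le, hnorm]
  have huz1 : ‖u - z‖ = s * d := by
    rw [huz, norm_neg, norm_smul, Real.norm_of_nonneg hs0.le, hnorm]
  have hn1 : ‖u - p‖⁻¹ • (u - p) = n := by
    rw [hup1, hup, smul_smul, hn]; congr 1; field_simp
  have hn2 : ‖u - z‖⁻¹ • (u - z) = -n := by
    rw [huz1, huz, smul_neg, smul_smul, hn]; congr 2; field_simp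
  have hup0 : 0 < ‖u - p‖ := by rw [hup1]; positivity
  have huz0 : 0 < ‖u - z‖ := by rw [huz1]; positivity
  -- The distance is squeezed between `d - ‖x - z‖` and `‖x - p‖`, which agree at `u` and have the
  -- same gradient `n` there.
  have hupper : ∀ x, Metric.infDist x A ≤
      (1 - s) * d + inner ℝ n (x - u) + ‖x - u‖ ^ 2 / (2 * ‖u - p‖) := fun x => by
    have h1 := norm_add_le_of_pos (h := x - u) hup0
    rw [hn1, hup1, add_comm (u - p), sub_add_sub_cancel, ← dist_eq_norm x p, ← hup1] at h1
    rw [← hup1]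
    exact (Metric.infDist_le_dist_of_mem hp).trans h1
  have hlower : ∀ x, (1 - s) * d + inner ℝ n (x - u) - ‖x - u‖ ^ 2 / (2 * ‖u - z‖) ≤
      Metric.infDist x A := fun x => by
    have h1 := norm_add_le_of_pos (h := x - u) huz0
    rw [hn2, add_comm (u - z), sub_add_sub_cancel, ← dist_eq_norm x z, inner_neg_left] at h1
    have h2 := Metric.infDist_le_infDist_add_dist (s := A) (x := z) (y := x)
    rw [dist_comm z x] at h2
    linarith
  have hu0 : Metric.infDist u A = (1 - s) * d := by
    have h1 := hupper u
    have h2 := hlower u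
    simp at h1 h2
    exact le_antisymm h1 h2
  rw [hasGradientAt_iff_isLittleO]
  set K := max (1 / (2 * ‖u - p‖)) (1 / (2 * ‖u - z‖)) with hK
  have hO : (fun x => Metric.infDist x A - Metric.infDist u A - inner ℝ n (x - u))
      =O[𝓝 u] fun x => ‖x - u‖ ^ 2 := by
    refine Asymptotics.IsBigO.of_bound K (Eventually.of_forall fun x => ?_)
    have h1 := hupper x
    have h2 := hlower x
    have h3 : ‖x - u‖ ^ 2 / (2 * ‖u - p‖) ≤ K * ‖x - u‖ ^ 2 := by
      rw [div_eq_mul_one_div, mul_comm]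
      gcongr
      exact le_max_left _ _
    have h4 : ‖x - u‖ ^ 2 / (2 * ‖u - z‖) ≤ K * ‖x - u‖ ^ 2 := by
      rw [div_eq_mul_one_div, mul_comm]
      gcongr
      exact le_max_right _ _
    rw [hu0, Real.norm_eq_abs, Real.norm_of_nonneg (sq_nonneg _), abs_le]
    constructor <;> linarith
  refine hO.trans_isLittleO ?_
  have h1 : Tendsto (fun x => ‖x - u‖) (𝓝 u) (𝓝 0) := by
    have : Continuous fun x => ‖x - u‖ := by fun_prop
    simpa using this.tendsto u
  have h2 : (fun x => ‖x - u‖ * ‖x - u‖) =o[𝓝 u] fun x => (1 : ℝ) * ‖x - u‖ :=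
    ((Asymptotics.isLittleO_one_iff ℝ).2 h1).mul_isBigO (Asymptotics.isBigO_refl _ _)
  simpa [sq, Asymptotics.isLittleO_norm_right] using h2

end Separation

/-! ### Clarke gradient bounds and pointedness of the normals -/

section Clarke

variable {d : ℕ}

/-- The directions from the nearest points belong to the Clarke gradient of the distance. -/
theorem smul_sub_mem_clarkeGradient {A : Set (Euc d)} {z p : Euc d} (hp : p ∈ A)
    (hzp : dist z p = Metric.infDist z A) (hpos : 0 < Metric.infDist z A) :
    (Metric.infDist z A)⁻¹ • (z - p) ∈ clarkeGradient (distFun A) z := by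
  have hg := fun k : ℕ => hasGradientAt_infDist_lineMap hp hzp (s := 1 / ((k : ℝ) + 2))
    (by positivity) (by rw [div_lt_one (by positivity)]; linarith [k.cast_nonneg (α := ℝ)]) hpos
  refine subset_convexHull ℝ _ ⟨fun k : ℕ => z + (1 / ((k : ℝ) + 2)) • (p - z), ?_,
    fun k => (hg k).differentiableAt, ?_⟩
  · have h1 : Tendsto (fun k : ℕ => 1 / ((k : ℝ) + 2)) atTop (𝓝 0) :=
      tendsto_const_nhds.div_atTop
        (tendsto_atTop_add_const_right _ _ tendsto_natCast_atTop_atTop)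
    simpa using (h1.smul_const (p - z)).const_add z
  · refine tendsto_const_nhds.congr fun k => ?_
    exact (hg k).gradient.symm

/-- A lower bound on the Clarke gradient of the distance yields a direction of increase. -/
theorem exists_forall_mul_infDist_le_inner {A : Set (Euc d)} (hA : IsClosed A) (hne : A.Nonempty)
    {z : Euc d} {μ : ℝ} (hμ : 0 < μ) (hpos : 0 < Metric.infDist z A)
    (h : μ ≤ minNorm (clarkeGradient (distFun A) z)) :
    ∃ v : Euc d, ‖v‖ = 1 ∧ ∀ p ∈ A, dist z p = Metric.infDist z A →
      μ * Metric.infDist z A ≤ inner ℝ v (z - p) := by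
  set N := {n | ∃ p ∈ A, dist z p = Metric.infDist z A ∧
    n = (Metric.infDist z A)⁻¹ • (z - p)} with hN
  have hNne : N.Nonempty := by
    obtain ⟨p, hp, hzp⟩ := hA.exists_infDist_eq_dist hne z
    exact ⟨_, p, hp, hzp.symm, rfl⟩
  obtain ⟨v, hv, hmin⟩ := exists_mem_closure_convexHull_norm_sq_le_inner hNne
  have hsub : convexHull ℝ N ⊆ clarkeGradient (distFun A) z := by
    refine convexHull_min ?_ (convex_convexHull ℝ _)
    rintro _ ⟨p, hp, hzp, rfl⟩
    exact smul_sub_mem_clarkeGradient hp hzp hpos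
  have hvμ : μ ≤ ‖v‖ := by
    rw [minNorm, ← Metric.infDist_closure] at h
    have := Metric.infDist_le_dist_of_mem (x := (0 : Euc d)) (closure_mono hsub hv)
    rw [dist_zero_left] at this
    exact h.trans this
  have hv0 : 0 < ‖v‖ := hμ.trans_le hvμ
  refine ⟨‖v‖⁻¹ • v, by rw [norm_smul, norm_inv, norm_norm, inv_mul_cancel₀ hv0.ne'],
    fun p hp hzp => ?_⟩
  have h1 := hmin _ ⟨p, hp, hzp, rfl⟩
  rw [inner_smul_right, ← div_eq_inv_mul, le_div_iff₀ hpos] at h1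
  rw [inner_smul_left, conj_trivial, ← div_eq_inv_mul, le_div_iff₀ hv0]
  refine le_trans ?_ h1
  rw [sq, mul_right_comm]
  gcongr

/-- The distance to the complement of the ball of a unit normal. -/
theorem infDist_le_of_mem_unitNormals {X : Set (Euc d)} {r : ℝ} (hr : 0 < r) {x n z : Euc d}
    (hx : x ∈ X) (hn : n ∈ unitNormals (complementSet X) r x) (hnz : 0 ≤ inner ℝ n (z - x))
    (hzr : ‖z - x‖ < r) : Metric.infDist z X ≤ ‖z - x‖ ^ 2 / r := by
  obtain ⟨-, hn1, hn⟩ := hn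
  rcases eq_or_ne z x with rfl | hzx
  · rw [Metric.infDist_zero_of_mem hx]; positivity
  have hw0 : 0 < ‖z - x‖ := norm_pos_iff.2 (sub_ne_zero.2 hzx)
  set s := ‖z - x‖ ^ 2 / r with hs
  have hs0 : 0 < s := by positivity
  -- Moving `z` by `s` along `n` brings it into the ball of radius `r` tangent at `x`.
  have hrs : r * s = ‖z - x‖ ^ 2 := by rw [hs]; field_simp
  have hsw : s < ‖z - x‖ := by rw [hs, div_lt_iff₀ hr]; nlinarith
  have hq : z + s • n ∈ X := by
    by_contra hqX
    have h1 := hn (z + s • n) (subset_closure hqX)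
    have h2 : z + s • n - x = (z - x) + s • n := by abel
    rw [h2, inner_add_right, inner_smul_right, real_inner_self_eq_norm_sq, norm_add_sq_real,
      inner_smul_right, norm_smul, hn1, real_inner_comm, Real.norm_of_nonneg hs0.le] at h1
    rw [real_inner_comm] at hnz
    nlinarith
  refine (Metric.infDist_le_dist_of_mem hq).trans ?_
  rw [dist_eq_norm, sub_add_cancel_left, norm_neg, norm_smul, hn1, mul_one,
    Real.norm_of_nonneg hs0.le]

/-- If the Clarke gradient of `d_X` is bounded away from zero near `X`, the unit normals to the
complement set at a boundary point lie in an open half-space. -/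
theorem exists_forall_unitNormals_inner_pos {X : Set (Euc d)} (hX : IsClosed X) {r μ s : ℝ}
    (hr : 0 < r) (hμ : 0 < μ) (hμ1 : μ ≤ 1) (hs : 0 < s)
    (hΔ : ∀ z, 0 < Metric.infDist z X → Metric.infDist z X ≤ s →
      μ ≤ minNorm (clarkeGradient (distFun X) z))
    {x : Euc d} (hx : x ∈ X) (hxC : x ∈ complementSet X) :
    ∃ v, ∀ n ∈ unitNormals (complementSet X) r x, 0 < inner ℝ n v := by
  refine (isCompact_unitNormals isClosed_closure r x).exists_forall_inner_pos_or.resolve_right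
    fun hall => ?_
  have hne : X.Nonempty := ⟨x, hx⟩
  -- As `‖z - x‖ ≤ 2 * t`, the first two bounds keep `z` within the ranges `s` and `r`; the third
  -- makes `4 * t ^ 2 / r` smaller than the gain `μ / 2 * t`.
  set t := min (min (s / 2) (r / 4)) (μ * r / 16) with ht
  have ht0 : 0 < t := by positivity
  have ht1 : t ≤ s / 2 := (min_le_left _ _).trans (min_le_left _ _)
  have ht2 : t ≤ r / 4 := (min_le_left _ _).trans (min_le_right _ _)
  have ht3 : t ≤ μ * r / 16 := min_le_right _ _
  obtain ⟨y, hyX, hxy⟩ := Metric.mem_closure_iff.1 hxC t ht0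
  have hy0 : 0 < Metric.infDist y X := (hX.notMem_iff_infDist_pos hne).1 hyX
  have hzx : ∀ z, dist z y ≤ t → ‖z - x‖ ≤ 2 * t := fun z hz => by
    rw [← dist_eq_norm]
    have := dist_triangle_right z x y
    linarith
  obtain ⟨z, hzy, hz⟩ := exists_dist_eq_add_mul_le_of_ascent
    (g := fun z => Metric.infDist z X) (Metric.continuous_infDist_pt X) (y := y) (m := μ / 2)
    ht0.le (by positivity) fun z hz hyz δ hδ => by
      have hz0 : 0 < Metric.infDist z X := hy0.trans_le hyz
      have hzs : Metric.infDist z X ≤ s := by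
        have h1 := Metric.infDist_le_dist_of_mem (x := z) hx
        rw [dist_eq_norm] at h1
        linarith [hzx z hz.le]
      obtain ⟨v, hv, hvp⟩ := exists_forall_mul_infDist_le_inner hX hne hμ hz0 (hΔ z hz0 hzs)
      refine exists_infDist_add_mul_lt_of_inner hX hne hv (by positivity) (by linarith)
        (fun p hp hzp => lt_of_lt_of_le ?_ (hvp p hp hzp)) hδ
      nlinarith
  have hzx' := hzx z hzy.le
  obtain ⟨n, hn, hnz⟩ := hall (z - x)
  have h1 := infDist_le_of_mem_unitNormals hr hx hn hnz (by linarith)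
  have h2 : ‖z - x‖ ^ 2 ≤ (2 * t) ^ 2 := by gcongr
  rw [le_div_iff₀ hr] at h1
  have h3 : 0 < Metric.infDist y X * r := by positivity
  nlinarith [mul_le_mul_of_nonneg_right hz hr.le]

end Clarke

/-! ### Patching inward directions -/

section Field

variable {E : Type*} [NormedAddCommGroup E] [InnerProductSpace ℝ E] [FiniteDimensional ℝ E]

open scoped Manifold ContDiff in
/-- Pointwise strict inward directions along which a continuous vector field `g` decreases patch
together to a compactly supported smooth vector field. -/
theorem exists_vectorField_of_forall_exists {C : Set E} (hC : IsClosed C) {r : ℝ} {M : Set E}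
    (hM : IsCompact M) {g : E → E} (hg : Continuous g)
    (hv : ∀ x ∈ M, ∃ v, (∀ n ∈ unitNormals C r x, 0 < inner ℝ n v) ∧ inner ℝ (g x) v < 0) :
    ∃ w : E → E, ContDiff ℝ 1 w ∧ HasCompactSupport w ∧
      (∀ x, ∀ n ∈ unitNormals C r x, 0 ≤ inner ℝ n (w x)) ∧ (∀ x, inner ℝ (g x) (w x) ≤ 0) ∧
      ∀ x ∈ M, inner ℝ (g x) (w x) ≤ -1 := by
  let t : E → Set E := fun x => {v | (∀ n ∈ unitNormals C r x, 0 ≤ inner ℝ n v) ∧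
    inner ℝ (g x) v ≤ 0 ∧ (x ∈ M → inner ℝ (g x) v ≤ -1)}
  have ht : ∀ x, Convex ℝ (t x) := by
    rintro x u ⟨hu1, hu2, hu3⟩ v ⟨hv1, hv2, hv3⟩ α β hα hβ hαβ
    refine ⟨fun n hn => ?_, ?_, fun hx => ?_⟩ <;>
      rw [inner_add_right, inner_smul_right, inner_smul_right]
    · have := hu1 n hn
      have := hv1 n hn
      positivity
    · nlinarith
    · nlinarith [hu3 hx, hv3 hx]
  have hloc : ∀ x, ∃ c : E, ∀ᶠ y in 𝓝 x, c ∈ t y := by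
    intro x
    by_cases hx : x ∈ M
    · obtain ⟨v, hvn, hvg⟩ := hv x hx
      -- Normalising to `-2` leaves room for the bound `-1` at nearby points.
      set c := (-2 / inner ℝ (g x) v) • v with hc
      have hpos : 0 < -2 / inner ℝ (g x) v := div_pos_of_neg_of_neg (by norm_num) hvg
      have hcg : inner ℝ (g x) c = -2 := by
        rw [hc, inner_smul_right, div_mul_cancel₀ _ hvg.ne]
      have h1 : ∀ᶠ y in 𝓝 x, inner ℝ (g y) c < -1 :=
        (by fun_prop : Continuous fun y => inner ℝ (g y) c).continuousAt.eventually_lt_const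
          (hcg.trans_lt (by norm_num))
      have h2 : ∀ᶠ y in 𝓝 x, ∀ n ∈ Metric.sphere (0 : E) 1,
          n ∈ unitNormals C r y → 0 < inner ℝ n c := by
        refine (isCompact_sphere (0 : E) 1).eventually_forall_of_forall_eventually fun n _ => ?_
        by_cases hn : n ∈ unitNormals C r x
        · have : ∀ᶠ q : E × E in 𝓝 (x, n), 0 < inner ℝ q.2 c :=
            (by fun_prop : Continuous fun q : E × E => inner ℝ q.2 c).continuousAt.eventually_const_lt
              ((mul_pos hpos (hvn n hn)).trans_eq (inner_smul_right _ _ _).symm)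
          filter_upwards [this] with q hq _ using hq
        · filter_upwards [(isClosed_unitNormals_graph hC r).isOpen_compl.mem_nhds
            (show (x, n) ∈ _ from hn)] with q hq h using absurd h hq
      refine ⟨c, ?_⟩
      filter_upwards [h1, h2] with y hy1 hy2
      exact ⟨fun n hn => (hy2 n (by simpa using hn.2.1) hn).le, by linarith, fun _ => hy1.le⟩
    · refine ⟨0, ?_⟩
      filter_upwards [hM.isClosed.isOpen_compl.mem_nhds hx] with y hy
      exact ⟨by simp, by simp, fun h => absurd h hy⟩
  obtain ⟨w, hw⟩ := exists_contMDiffMap_forall_mem_convex_of_local_const (n := 1) 𝓘(ℝ, E) ht hloc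
  obtain ⟨R, hR0, hR⟩ := hM.isBounded.exists_pos_norm_le
  let χ : ContDiffBump (0 : E) := ⟨R, R + 1, hR0, by linarith⟩
  have hχ : ContDiff ℝ 1 χ := χ.contDiff
  refine ⟨fun x => χ x • w x, hχ.smul w.contMDiff.contDiff, χ.hasCompactSupport.smul_right,
    fun x n hn => ?_, fun x => ?_, fun x hx => ?_⟩
  · rw [inner_smul_right]
    exact mul_nonneg χ.nonneg ((hw x).1 n hn)
  · rw [inner_smul_right]
    exact mul_nonpos_of_nonneg_of_nonpos χ.nonneg (hw x).2.1
  · change inner ℝ (g x) (χ x • w x) ≤ -1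
    rw [χ.one_of_mem_closedBall (by simpa using hR x hx), one_smul]
    exact (hw x).2.2 hx

end Field

/-! ### Invariance and existence of the flow -/

section Flow

variable {E : Type*} [NormedAddCommGroup E] [InnerProductSpace ℝ E]

/-- A closed set is forward invariant under a Lipschitz vector field which makes an obtuse angle
with the proximal normals of the set. -/
theorem mem_of_hasDerivWithinAt_of_inner_nonpos [ProperSpace E] {X : Set E} (hX : IsClosed X)
    {w : E → E} {K : NNReal} (hw : LipschitzWith K w)
    (hin : ∀ y, ∀ p ∈ X, dist y p = Metric.infDist y X → inner ℝ (w p) (y - p) ≤ 0)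
    {γ : ℝ → E} {T : ℝ} (hγ : ∀ t ∈ Icc 0 T, HasDerivWithinAt γ (w (γ t)) (Icc 0 T) t)
    (h0 : γ 0 ∈ X) : ∀ t ∈ Icc 0 T, γ t ∈ X := by
  have hne : X.Nonempty := ⟨_, h0⟩
  have hcont : ContinuousOn γ (Icc 0 T) := fun t ht => (hγ t ht).continuousWithinAt
  have key := le_gronwallBound_of_liminf_deriv_right_le (δ := 0) (ε := 0) (K := 2 * K)
    (f := fun t => Metric.infDist (γ t) X ^ 2)
    (f' := fun t => 2 * K * Metric.infDist (γ t) X ^ 2) (a := 0) (b := T)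
    (((Metric.continuous_infDist_pt X).comp_continuousOn hcont).pow 2) (fun t ht ρ hρ => ?_)
    (by simp [Metric.infDist_zero_of_mem h0]) (fun t _ => by simp)
  · intro t ht
    have h := key t ht
    simp only [gronwallBound_ε0, zero_mul] at h
    rw [hX.mem_iff_infDist_zero hne]
    exact pow_eq_zero_iff two_ne_zero |>.1 (le_antisymm h (sq_nonneg _))
  · obtain ⟨p, hp, hpd⟩ := hX.exists_infDist_eq_dist hne (γ t)
    have hder : HasDerivWithinAt γ (w (γ t)) (Ioi t) t :=
      (hγ t (Ico_subset_Icc_self ht)).mono_of_mem_nhdsWithin (Icc_mem_nhdsGT_of_mem ht)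
    have hF := (hder.sub_const p).norm_sq
    -- The smooth function `‖γ - p‖ ^ 2` dominates the squared distance, with equality at time `t`.
    -- Comparing `w (γ t)` with `w p` costs only the Lipschitz constant.
    have hle : 2 * inner ℝ (γ t - p) (w (γ t)) ≤ 2 * K * Metric.infDist (γ t) X ^ 2 := by
      have h1 : inner ℝ (γ t - p) (w (γ t)) =
          inner ℝ (γ t - p) (w (γ t) - w p) + inner ℝ (w p) (γ t - p) := by
        rw [inner_sub_right, real_inner_comm (w p)]; ring
      have h2 : inner ℝ (γ t - p) (w (γ t) - w p) ≤ ‖γ t - p‖ * (K * ‖γ t - p‖) :=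
        (real_inner_le_norm _ _).trans (by gcongr; exact hw.norm_sub_le _ _)
      have h3 := hin (γ t) p hp hpd.symm
      rw [hpd, dist_eq_norm]
      nlinarith
    refine Eventually.frequently ?_
    filter_upwards [hF.limsup_slope_le' (notMem_Ioi.2 le_rfl) (hle.trans_lt hρ),
      self_mem_nhdsWithin] with z hz hzt
    refine lt_of_le_of_lt ?_ hz
    rw [slope_def_field, div_eq_inv_mul]
    have hzt' : 0 < z - t := sub_pos.2 hzt
    have h1 : Metric.infDist (γ z) X ≤ ‖γ z - p‖ := by
      rw [← dist_eq_norm]; exact Metric.infDist_le_dist_of_mem hp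
    have h2 : Metric.infDist (γ z) X ^ 2 ≤ ‖γ z - p‖ ^ 2 := by
      have := Metric.infDist_nonneg (x := γ z) (s := X)
      gcongr
    rw [hpd, dist_eq_norm]
    gcongr

/-- The flow of a compactly supported `C¹` vector field, on a bounded set and up to time `T`. -/
theorem exists_flow_of_hasCompactSupport [CompleteSpace E] {w : E → E} {K : NNReal}
    (hw : LipschitzWith K w) (hc : HasCompactSupport w) {S : Set E} (hS : Bornology.IsBounded S)
    {T : ℝ} (hT : 0 ≤ T) :
    ∃ φ : E × ℝ → E, ContinuousOn φ (S ×ˢ Icc 0 T) ∧ ∀ x ∈ S, φ (x, 0) = x ∧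
      ∀ t ∈ Icc 0 T, HasDerivWithinAt (fun t => φ (x, t)) (w (φ (x, t))) (Icc 0 T) t := by
  obtain ⟨B, hB⟩ := hc.exists_bound_of_continuous hw.continuous
  obtain ⟨R, hR0, hR⟩ := hS.exists_pos_norm_le
  have hSR : S ⊆ Metric.closedBall 0 R := fun x hx => by simpa using hR x hx
  have hPL : IsPicardLindelof (fun _ => w) (⟨0, le_rfl, hT⟩ : Icc 0 T) 0
      (R.toNNReal + B.toNNReal * T.toNNReal) R.toNNReal B.toNNReal K := by
    refine .of_time_independent (fun x _ => (hB x).trans (Real.le_coe_toNNReal B))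
      hw.lipschitzOnWith ?_
    simp [hT]
  obtain ⟨φ, hφ, hφc⟩ := hPL.exists_forall_mem_closedBall_eq_hasDerivWithinAt_continuousOn
  rw [Real.coe_toNNReal R hR0.le] at hφ hφc
  exact ⟨φ, hφc.mono (prod_mono hSR le_rfl), fun x hx => hφ x (hSR hx)⟩

end Flow

/-! ### Complementary regular sets and the retraction -/

section ComplementaryRegular

variable {d : ℕ}

/-- Dividing the normal inequality by `2 * r * ‖u k - x‖` leaves the error `‖u k - x‖ / (2 * r)`,
which tends to 0. -/
theorem inner_nonpos_of_mem_tanCone {C : Set (Euc d)} {r : ℝ} (hr : 0 < r) {x n τ : Euc d}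
    (hn : n ∈ unitNormals C r x) (hτ : τ ∈ tanCone C x) : inner ℝ n τ ≤ 0 := by
  obtain ⟨l, w, hl, rfl, u, hu, hux, huw⟩ := hτ
  rw [inner_smul_right]
  refine mul_nonpos_of_nonneg_of_nonpos hl ?_
  have h1 : Tendsto (fun k => inner ℝ n (‖u k - x‖⁻¹ • (u k - x))) atTop (𝓝 (inner ℝ n w)) :=
    tendsto_const_nhds.inner huw
  have h2 : Tendsto (fun k => ‖u k - x‖ / (2 * r)) atTop (𝓝 0) := by
    simpa using (tendsto_iff_norm_sub_tendsto_zero.1 hux).div_const (2 * r)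
  refine le_of_tendsto_of_tendsto' h1 h2 fun k => ?_
  have hpos : 0 < ‖u k - x‖ := norm_pos_iff.2 (sub_ne_zero.2 (hu k).2)
  rw [inner_smul_right, inv_mul_le_iff₀ hpos, mul_div_assoc', le_div_iff₀ (by positivity)]
  linarith [hn.2.2 (u k) (hu k).1]

theorem exists_radius_of_reach_pos {A : Set (Euc d)} (hA : 0 < reach A) :
    ∃ r : ℝ, 0 < r ∧ ∀ z, Metric.infDist z A < r → ∀ p ∈ A, ∀ q ∈ A,
      dist z p = Metric.infDist z A → dist z q = Metric.infDist z A → p = q := by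
  obtain ⟨t, ht, ht0⟩ := lt_sSup_iff.1 hA
  obtain ⟨r, hr0, hrt⟩ := ENNReal.lt_iff_exists_nnreal_btwn.1 ht0
  refine ⟨r, by exact_mod_cast hr0, fun z hz p hp q hq hzp hzq => ?_⟩
  have hfin : Metric.infEDist z A ≠ ⊤ := Metric.infEDist_ne_top ⟨p, hp⟩
  have hE : Metric.infEDist z A = ENNReal.ofReal (Metric.infDist z A) :=
    (ENNReal.ofReal_toReal hfin).symm
  refine (ht z ?_).unique ⟨hp, ?_⟩ ⟨hq, ?_⟩
  · refine lt_trans ?_ hrt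
    rw [hE, ENNReal.ofReal_lt_coe_iff Metric.infDist_nonneg]
    exact hz
  · rw [edist_dist, hzp, hE]
  · rw [edist_dist, hzq, hE]

theorem exists_forall_le_minNorm_of_muReach_pos {X : Set (Euc d)} (hne : X.Nonempty) {μ : ℝ}
    (h : 0 < muReach μ X) : ∃ s : ℝ, 0 < s ∧ ∀ z, 0 < Metric.infDist z X →
      Metric.infDist z X ≤ s → μ ≤ minNorm (clarkeGradient (distFun X) z) := by
  obtain ⟨t, ht, ht0⟩ := lt_sSup_iff.1 h
  obtain ⟨s, hs0, hst⟩ := ENNReal.lt_iff_exists_nnreal_btwn.1 ht0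
  refine ⟨s, by exact_mod_cast hs0, fun z hz hzs => ?_⟩
  have hE : Metric.infEDist z X = ENNReal.ofReal (Metric.infDist z X) :=
    (ENNReal.ofReal_toReal (Metric.infEDist_ne_top hne)).symm
  refine ht z ?_ (le_trans ?_ hst.le)
  · rw [hE]; exact ENNReal.ofReal_pos.2 hz
  · rw [hE]; exact ENNReal.ofReal_le_of_le_toReal (by simpa using hzs)

/-- When `closure (interior X) = X`, points of `X` are limits of points off `complementSet X`, as
`unitNormals_nonempty` requires. -/
theorem closure_compl_complementSet (X : Set (Euc d)) :
    closure (complementSet X)ᶜ = closure (interior X) := by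
  rw [complementSet, interior_eq_compl_closure_compl]

/-- A vector field with nonnegative products with the unit normals to the complement set makes an
obtuse angle with the proximal normals to the set. -/
theorem inner_nonpos_of_forall_unitNormals {X : Set (Euc d)} (hX : IsClosed X)
    (hint : closure (interior X) = X) {r : ℝ} (hr : 0 < r)
    (huniq : ∀ z, Metric.infDist z (complementSet X) < r → ∀ p ∈ complementSet X,
      ∀ q ∈ complementSet X, dist z p = Metric.infDist z (complementSet X) →
      dist z q = Metric.infDist z (complementSet X) → p = q)
    {y p v : Euc d} (hp : p ∈ X) (hyp : dist y p = Metric.infDist y X)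
    (hv : ∀ n ∈ unitNormals (complementSet X) r p, 0 ≤ inner ℝ n v) :
    inner ℝ v (y - p) ≤ 0 := by
  by_cases hy : y ∈ X
  · rw [Metric.infDist_zero_of_mem hy, dist_eq_zero] at hyp
    simp [hyp]
  set ρ := Metric.infDist y X with hρ
  have hρ0 : 0 < ρ := (hX.notMem_iff_infDist_pos ⟨p, hp⟩).1 hy
  have hball : Metric.closedBall y ρ ⊆ complementSet X := by
    rw [← closure_ball y hρ0.ne']
    refine closure_mono fun q hq hqX => ?_
    have := Metric.infDist_le_dist_of_mem (x := y) hqX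
    rw [Metric.mem_ball'] at hq
    linarith
  have hpC : p ∈ complementSet X := hball (by rw [Metric.mem_closedBall']; exact hyp.le)
  obtain ⟨n, hn⟩ := unitNormals_nonempty isClosed_closure hr huniq hpC
    (((closure_compl_complementSet X).trans hint).symm.subset hp)
  have hyp' : y - p = ρ • ρ⁻¹ • (y - p) := (smul_inv_smul₀ hρ0.ne' _).symm
  have hnν := eq_neg_of_mem_unitNormals_of_closedBall_subset (ν := ρ⁻¹ • (y - p)) hr hρ0
    (by rw [norm_smul, ← dist_eq_norm, hyp, norm_inv, Real.norm_of_nonneg hρ0.le,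
      inv_mul_cancel₀ hρ0.ne']) hn (by rwa [← hyp', add_sub_cancel])
  have h := hv n hn
  rw [hnν, inner_neg_left] at h
  rw [hyp', inner_smul_right, real_inner_comm]
  exact mul_nonpos_of_nonneg_of_nonpos hρ0.le (by linarith)

/-- At a non-critical point there is a strictly inward direction along which `f` decreases. -/
theorem exists_inner_pos_and_inner_gradient_neg {X : Set (Euc d)} {r : ℝ} (hr : 0 < r)
    {f : Euc d → ℝ} {x : Euc d} (hx : x ∈ X)
    (hpointed : x ∈ complementSet X → ∃ v, ∀ n ∈ unitNormals (complementSet X) r x, 0 < inner ℝ n v)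
    (hreg : ¬ IsCriticalPointOn f X x) :
    ∃ v, (∀ n ∈ unitNormals (complementSet X) r x, 0 < inner ℝ n v) ∧
      inner ℝ (gradient f x) v < 0 := by
  have hfr : x ∈ frontier X ↔ x ∈ complementSet X := by
    rw [frontier_eq_closure_inter_closure]
    exact and_iff_right (subset_closure hx)
  by_cases hxC : x ∈ complementSet X
  · have hpol : gradient f x ∉ polarCone (tanCone (complementSet X) x) := fun h =>
      hreg ⟨hx, fun _ => by rwa [neg_neg], fun h' => absurd (hfr.2 hxC) h'⟩
    obtain ⟨τ, hτ, hτ0⟩ : ∃ τ ∈ tanCone (complementSet X) x, 0 < inner ℝ (gradient f x) τ := by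
      by_contra! h
      exact hpol h
    obtain ⟨v, hv⟩ := hpointed hxC
    set i := inner ℝ (gradient f x) τ with hi
    set j := inner ℝ (gradient f x) v with hj
    -- This choice gives `ε * j < i`.
    set ε := i / (|j| + 1) with hε
    have hε0 : 0 < ε := by positivity
    refine ⟨ε • v - τ, fun n hn => ?_, ?_⟩
    · rw [inner_sub_right, inner_smul_right]
      have := mul_pos hε0 (hv n hn)
      linarith [inner_nonpos_of_mem_tanCone hr hn hτ]
    · rw [inner_sub_right, inner_smul_right, ← hi, ← hj, sub_neg, hε, div_mul_eq_mul_div,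
        div_lt_iff₀ (by positivity)]
      nlinarith [le_abs_self j]
  · have hg : gradient f x ≠ 0 := fun h =>
      hreg ⟨hx, fun h' => absurd (hfr.1 h') hxC, fun _ => by rw [h, neg_zero]⟩
    refine ⟨-gradient f x, fun n hn => absurd hn.1 hxC, ?_⟩
    rw [inner_neg_right, real_inner_self_eq_norm_sq, neg_lt_zero]
    positivity

/-- A flow which preserves `X` and decreases `f` at unit speed on `X ∩ f⁻¹ [a, b]` retracts
`X_b` onto `X_a`. -/
theorem isDeformationRetract_of_flow {X : Set (Euc d)} {f : Euc d → ℝ}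
    (hf : Differentiable ℝ f) {a b : ℝ} (hab : a ≤ b) {w : Euc d → Euc d} {φ : Euc d × ℝ → Euc d}
    (hφc : ContinuousOn φ (X ×ˢ Icc 0 (b - a))) (hφ0 : ∀ x ∈ X, φ (x, 0) = x)
    (hφX : ∀ x ∈ X, ∀ t ∈ Icc 0 (b - a), φ (x, t) ∈ X)
    (hφ : ∀ x ∈ X, ∀ t ∈ Icc 0 (b - a),
      HasDerivWithinAt (fun t => φ (x, t)) (w (φ (x, t))) (Icc 0 (b - a)) t)
    (hw : ∀ x, inner ℝ (gradient f x) (w x) ≤ 0)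
    (hw1 : ∀ x ∈ X ∩ f ⁻¹' Icc a b, inner ℝ (gradient f x) (w x) ≤ -1) :
    IsDeformationRetract (sublevelOn f X a) (sublevelOn f X b) := by
  have hder : ∀ x ∈ X, ∀ t ∈ Icc 0 (b - a), HasDerivWithinAt (fun t => f (φ (x, t)))
      (inner ℝ (gradient f (φ (x, t))) (w (φ (x, t)))) (Icc 0 (b - a)) t := fun x hx t ht => by
    have h := (hf (φ (x, t))).hasFDerivAt.comp_hasDerivWithinAt t (hφ x hx t ht)
    rw [← toDual_gradient, InnerProductSpace.toDual_apply_apply] at h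
    exact h
  have hcont : ∀ x ∈ X, ContinuousOn (fun t => f (φ (x, t))) (Icc 0 (b - a)) :=
    fun x hx t ht => (hder x hx t ht).continuousWithinAt
  have hder' : ∀ x ∈ X, ∀ t ∈ interior (Icc 0 (b - a)), HasDerivAt (fun t => f (φ (x, t)))
      (inner ℝ (gradient f (φ (x, t))) (w (φ (x, t)))) t := fun x hx t ht =>
    (hder x hx t (interior_subset ht)).hasDerivAt (mem_interior_iff_mem_nhds.1 ht)
  have hanti : ∀ x ∈ X, AntitoneOn (fun t => f (φ (x, t))) (Icc 0 (b - a)) := fun x hx =>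
    antitoneOn_of_deriv_nonpos (convex_Icc _ _) (hcont x hx)
      (fun t ht => (hder' x hx t ht).differentiableAt.differentiableWithinAt)
      fun t ht => by rw [(hder' x hx t ht).deriv]; exact hw _
  let τ : Euc d → ℝ := fun x => max (f x - a) 0
  have hτc : Continuous τ := by have := hf.continuous; fun_prop
  have hτ : ∀ x ∈ sublevelOn f X b, τ x ∈ Icc 0 (b - a) := fun x hx =>
    have hxb : f x ≤ b := hx.2
    ⟨le_max_right _ _, max_le (by linarith) (by linarith)⟩
  have h0 : (0 : ℝ) ∈ Icc 0 (b - a) := ⟨le_rfl, by linarith⟩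
  have hend : ∀ x ∈ sublevelOn f X b, f (φ (x, τ x)) ≤ a := by
    intro x hx
    -- If `f` were still above `a`, the trajectory would have stayed in the strip and `f` would have
    -- dropped by at least `τ x = f x - a`.
    by_contra! hlt
    have hτx := hτ x hx
    have hsub : Icc 0 (τ x) ⊆ Icc 0 (b - a) := Icc_subset_Icc_right hτx.2
    have hfx : f (φ (x, τ x)) ≤ f x := by
      simpa [hφ0 x hx.1] using hanti x hx.1 h0 hτx hτx.1
    have hτeq : τ x = f x - a := max_eq_left (by linarith)
    have hslope : ∀ t ∈ Icc 0 (τ x),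
        inner ℝ (gradient f (φ (x, t))) (w (φ (x, t))) ≤ -1 := fun t ht => by
      refine hw1 _ ⟨hφX x hx.1 t (hsub ht), ?_, ?_⟩
      · exact hlt.le.trans (hanti x hx.1 (hsub ht) hτx ht.2)
      · have h := hanti x hx.1 h0 (hsub ht) ht.1
        simp only [hφ0 x hx.1] at h
        exact h.trans hx.2
    have hmvt := (convex_Icc 0 (τ x)).image_sub_le_mul_sub_of_deriv_le
      ((hcont x hx.1).mono hsub)
      (fun t ht => ((hder' x hx.1 t (interior_mono hsub ht)).differentiableAt).differentiableWithinAt)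
      (C := -1)
      (fun t ht => by
        rw [(hder' x hx.1 t (interior_mono hsub ht)).deriv]
        exact hslope t (interior_subset ht))
      0 (left_mem_Icc.2 hτx.1) (τ x) (right_mem_Icc.2 hτx.1) hτx.1
    simp only [hφ0 x hx.1] at hmvt
    linarith
  have hmem : ∀ (s : I) (x : sublevelOn f X b), (s : ℝ) * τ x ∈ Icc 0 (b - a) := fun s x =>
    ⟨mul_nonneg s.2.1 (hτ x x.2).1,
      (mul_le_of_le_one_left (hτ x x.2).1 s.2.2).trans (hτ x x.2).2⟩
  have hstay : ∀ (s : I) (x : sublevelOn f X b), φ (x, s * τ x) ∈ sublevelOn f X b := fun s x => by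
    refine ⟨hφX x x.2.1 _ (hmem s x), ?_⟩
    have h := hanti x x.2.1 h0 (hmem s x) (hmem s x).1
    simp only [hφ0 x x.2.1] at h
    exact h.trans x.2.2
  have hHc : Continuous fun q : I × sublevelOn f X b => φ (q.2, q.1 * τ q.2) := by
    refine hφc.comp_continuous ?_ fun q => ⟨q.2.2.1, hmem q.1 q.2⟩
    fun_prop
  let r : C(sublevelOn f X b, sublevelOn f X b) :=
    ⟨fun x => ⟨φ (x, (1 : I) * τ x), hstay 1 x⟩,
      (hHc.comp (by fun_prop : Continuous fun x : sublevelOn f X b => ((1 : I), x))).subtype_mk _⟩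
  refine ⟨fun x hx => ⟨hx.1, le_trans (show f x ≤ a from hx.2) hab⟩, r, fun x => ?_, ⟨⟨⟨⟨fun q =>
    ⟨φ (q.2, q.1 * τ q.2), hstay q.1 q.2⟩, hHc.subtype_mk _⟩, fun x => ?_, fun x => rfl⟩, ?_⟩⟩⟩
  · refine ⟨(hstay 1 x).1, ?_⟩
    change f (φ (x, (1 : I) * τ x)) ≤ a
    simpa using hend x x.2
  · ext1
    simp [hφ0 x x.2.1]
  · intro s x hx
    have hxa : f x ≤ a := hx.2
    have : τ x = 0 := max_eq_right (by linarith)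
    ext1
    simp [this, hφ0 x x.2.1]

end ComplementaryRegular

theorem mainTheorem4 (d : ℕ) (X : Set (Euc d)) (hX : IsComplementaryRegular X)
    (f : Euc d → ℝ) (hf : ContDiff ℝ 2 f) (a b : ℝ) (hab : a < b)
    (hreg : ∀ c ∈ Icc a b, IsRegularValueOn f X c) :
    IsDeformationRetract (sublevelOn f X a) (sublevelOn f X b) := by
  have hcl : IsClosed X := hX.isCompact.isClosed
  obtain ⟨r, hr, huniq⟩ := exists_radius_of_reach_pos hX.reach_complementSet_pos
  obtain ⟨μ, hμ, hμ1, hμX⟩ := hX.muReach_pos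
  have hgc : Continuous (gradient f) :=
    (InnerProductSpace.toDual ℝ (Euc d)).symm.continuous.comp (hf.continuous_fderiv (by norm_num))
  have hM : IsCompact (X ∩ f ⁻¹' Icc a b) :=
    hX.isCompact.inter_right (isClosed_Icc.preimage hf.continuous)
  obtain ⟨w, hw, hwc, hwn, hw0, hw1⟩ := exists_vectorField_of_forall_exists
    (C := complementSet X) isClosed_closure (r := r) hM hgc fun x hx => by
      obtain ⟨s, hs, hΔ⟩ := exists_forall_le_minNorm_of_muReach_pos ⟨x, hx.1⟩ hμX
      exact exists_inner_pos_and_inner_gradient_neg hr hx.1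
        (exists_forall_unitNormals_inner_pos hcl hr hμ hμ1 hs hΔ hx.1)
        fun hcrit => hreg _ hx.2 ⟨x, hcrit, rfl⟩
  obtain ⟨K, hK⟩ := hw.lipschitzWith_of_hasCompactSupport hwc one_ne_zero
  obtain ⟨φ, hφc, hφ⟩ := exists_flow_of_hasCompactSupport hK hwc hX.isCompact.isBounded
    (sub_nonneg.2 hab.le)
  refine isDeformationRetract_of_flow (hf.differentiable (by norm_num)) hab.le hφc
    (fun x hx => (hφ x hx).1) (fun x hx => ?_) (fun x hx => (hφ x hx).2) hw0 hw1
  refine mem_of_hasDerivWithinAt_of_inner_nonpos hcl hK (fun y p hp hyp => ?_) (hφ x hx).2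
    (by rw [(hφ x hx).1]; exact hx)
  exact inner_nonpos_of_forall_unitNormals hcl hX.closure_interior hr huniq hp hyp (hwn p)
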